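/- A non-zero element $k$ of a (complex) $C^*$-algebra $\mathcal{A}$ is said to be of \emph{algebraic rank one} if for every $a \in \mathcal{A}$ there is a complex number $\alpha$ such that $kak = \alpha k$. A $C^*$-algebra is \emph{elementary} if it is $^*$-isomorphic to the $C^*$-algebra $K(H)$ of all compact operators on some complex Hilbert space $H$, and it is \emph{dual} if it is $^*$-isomorphic to a direct sum of elementary algebras. Here the direct sum of a family $(\mathcal{K}_t)_{t \in T}$ of $C^*$-algebras is the $C^*$-algebra of all families $(x_t)_{t \in T}$ with $x_t \in \mathcal{K}_t$ such that $\{t \in T : \|x_t\| \ge \varepsilon\}$ is finite for every $\varepsilon > 0$, with pointwise operations and the supremum norm; the index set $T$ may be empty, in which case the direct sum is $\{0\}$. Let $\mathcal{A}$ be a unital $C^*$-algebra, and let $\mathcal{C}(\mathcal{A})$ denote the smallest closed two-sided ideal of $\mathcal{A}$ which contains all elements of algebraic rank one of $\mathcal{A}$. Then $\mathcal{C}(\mathcal{A})$, considered as a $C^*$-algebra, is a dual algebra. -/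

import Mathlib

open Filter Topology
open scoped ENNReal InnerProductSpace

noncomputable section

/-! ### Elements of algebraic rank one and the ideal they generate -/

/-- A non-zero element `k` of a C⋆-algebra `A` is *of algebraic rank one* if for every `a` in `A`
there is a complex number `α` such that `k a k = α k`. -/
def IsAlgebraicRankOne {A : Type*} [NonUnitalCStarAlgebra A] (k : A) : Prop :=
  k ≠ 0 ∧ ∀ a : A, ∃ α : ℂ, k * a * k = α • k

/-- The smallest closed (two-sided) ideal of the unital C⋆-algebra `A` which contains all elements
of algebraic rank one: the intersection of all closed ideals that contain them. -/
def algebraicallyCompactIdeal (A : Type*) [CStarAlgebra A] : TwoSidedIdeal A :=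
  sInf {I : TwoSidedIdeal A |
    IsClosed (I : Set A) ∧ ∀ k : A, IsAlgebraicRankOne k → k ∈ I}

theorem mem_algebraicallyCompactIdeal {A : Type*} [CStarAlgebra A] {x : A} :
    x ∈ algebraicallyCompactIdeal A ↔
      ∀ I : TwoSidedIdeal A, IsClosed (I : Set A) →
        (∀ k : A, IsAlgebraicRankOne k → k ∈ I) → x ∈ I := by
  simp only [algebraicallyCompactIdeal, TwoSidedIdeal.mem_sInf, Set.mem_ofPred_eq, and_imp]

theorem isClosed_algebraicallyCompactIdeal (A : Type*) [CStarAlgebra A] :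
    IsClosed (algebraicallyCompactIdeal A : Set A) := by
  have h : (algebraicallyCompactIdeal A : Set A) =
      ⋂ I ∈ {I : TwoSidedIdeal A |
        IsClosed (I : Set A) ∧ ∀ k : A, IsAlgebraicRankOne k → k ∈ I}, (I : Set A) := by
    ext x
    simp only [SetLike.mem_coe, mem_algebraicallyCompactIdeal, Set.mem_iInter,
      Set.mem_ofPred_eq, and_imp]
  rw [h]
  exact isClosed_biInter fun I hI => hI.1

theorem IsAlgebraicRankOne.star {A : Type*} [NonUnitalCStarAlgebra A] {k : A}
    (hk : IsAlgebraicRankOne k) : IsAlgebraicRankOne (star k) := by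
  refine ⟨star_ne_zero.2 hk.1, fun a => ?_⟩
  obtain ⟨α, hα⟩ := hk.2 (Star.star a)
  refine ⟨Star.star α, ?_⟩
  have h := congrArg Star.star hα
  simpa [mul_assoc] using h

theorem star_mem_algebraicallyCompactIdeal {A : Type*} [CStarAlgebra A] {x : A}
    (hx : x ∈ algebraicallyCompactIdeal A) : star x ∈ algebraicallyCompactIdeal A := by
  rw [mem_algebraicallyCompactIdeal] at hx ⊢
  intro I hI hk
  let J : TwoSidedIdeal A := TwoSidedIdeal.mk' {y : A | star y ∈ I}
    (by simp [I.zero_mem])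
    (fun {y z} hy hz => by simpa using I.add_mem hy hz)
    (fun {y} hy => by simpa using I.neg_mem hy)
    (fun {y z} hz => by simpa using I.mul_mem_right _ (star y) hz)
    (fun {y z} hy => by simpa using I.mul_mem_left (star z) _ hy)
  have hJ : (J : Set A) = star ⁻¹' (I : Set A) := by
    simp only [J, TwoSidedIdeal.coe_mk']
    rfl
  have hxJ : x ∈ J := hx J (by rw [hJ]; exact hI.preimage continuous_star) fun k hk' => by
    rw [← SetLike.mem_coe, hJ]
    exact hk _ hk'.star
  rw [← SetLike.mem_coe, hJ] at hxJ
  exact hxJ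

/-- `C(A)`, the smallest closed ideal of `A` which contains all elements of algebraic rank one,
considered as a C⋆-algebra (with the operations and the norm of `A`). -/
def algebraicallyCompact (A : Type*) [CStarAlgebra A] : NonUnitalStarSubalgebra ℂ A where
  carrier := (algebraicallyCompactIdeal A : Set A)
  zero_mem' := (algebraicallyCompactIdeal A).zero_mem
  add_mem' hx hy := (algebraicallyCompactIdeal A).add_mem hx hy
  mul_mem' {x y} _ hy := (algebraicallyCompactIdeal A).mul_mem_left x y hy
  smul_mem' c x hx := by
    have h := (algebraicallyCompactIdeal A).mul_mem_left (c • (1 : A)) x hx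
    rwa [smul_mul_assoc, one_mul] at h
  star_mem' hx := star_mem_algebraicallyCompactIdeal hx

instance isClosed_algebraicallyCompact (A : Type*) [CStarAlgebra A] :
    IsClosed (algebraicallyCompact A : Set A) :=
  isClosed_algebraicallyCompactIdeal A

/-! ### The algebra of compact operators -/

section CompactOperators

variable (H : Type*) [NormedAddCommGroup H] [InnerProductSpace ℂ H] [CompleteSpace H]

/-- Schauder's theorem on a Hilbert space: the adjoint of a compact operator is compact. -/
theorem isCompactOperator_star {T : H →L[ℂ] H} (hT : IsCompactOperator T) :
    IsCompactOperator (star T : H →L[ℂ] H) := by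
  set S : H →L[ℂ] H := star T with hSdef
  have hTS : IsCompactOperator (T ∘L S) := hT.comp_clm S
  obtain ⟨K, hK, hKs⟩ := IsCompactOperator.image_closedBall_subset_compact
    (f := ((T ∘L S : H →L[ℂ] H) : H →ₗ[ℂ] H)) hTS 1
  have htb := hK.totallyBounded.subset hKs
  refine (isCompactOperator_iff_isCompact_closure_image_closedBall
    (S : H →ₗ[ℂ] H) one_pos).2 ?_
  refine TotallyBounded.isCompact_of_isClosed (TotallyBounded.closure ?_) isClosed_closure
  rw [Metric.totallyBounded_iff]
  intro ε hε
  obtain ⟨t, hts, htf, htc⟩ :=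
    Metric.finite_approx_of_totallyBounded htb (ε ^ 2 / 2) (by positivity)
  have hts' : ∀ z ∈ t, ∃ g : H, g ∈ Metric.closedBall (0 : H) 1 ∧ T (S g) = z :=
    fun z hz => hts hz
  choose! g hg hgt using hts'
  refine ⟨(fun z => S (g z)) '' t, htf.image _, ?_⟩
  rintro _ ⟨y, hy, rfl⟩
  obtain ⟨z, hz, hyz⟩ := Set.mem_iUnion₂.1 (htc ⟨y, hy, rfl⟩)
  refine Set.mem_iUnion₂.2 ⟨S (g z), ⟨z, hz, rfl⟩, ?_⟩
  have hgz := hgt z hz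
  rw [← hgz] at hyz
  simp only [ContinuousLinearMap.coe_coe, ContinuousLinearMap.comp_apply, Metric.mem_ball,
    dist_eq_norm, ← map_sub] at hyz ⊢
  have hw : ‖y - g z‖ ≤ 2 := by
    have h1 : ‖y‖ ≤ 1 := by simpa using hy
    have h2 : ‖g z‖ ≤ 1 := by simpa using hg z hz
    linarith [norm_sub_le y (g z)]
  have key : ‖S (y - g z)‖ ^ 2 ≤ ‖T (S (y - g z))‖ * ‖y - g z‖ := by
    have h1 : ⟪S (y - g z), S (y - g z)⟫_ℂ = ⟪T (S (y - g z)), y - g z⟫_ℂ := by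
      rw [hSdef, ContinuousLinearMap.star_eq_adjoint, ContinuousLinearMap.adjoint_inner_right]
    have h2 := norm_inner_le_norm (𝕜 := ℂ) (T (S (y - g z))) (y - g z)
    rw [← h1, inner_self_eq_norm_sq_to_K] at h2
    simpa using h2
  have h3 : ‖S (y - g z)‖ ^ 2 < ε ^ 2 := by
    nlinarith [norm_nonneg (T (S (y - g z))), norm_nonneg (y - g z)]
  exact lt_of_pow_lt_pow_left₀ 2 hε.le h3

/-- `K(H)`, the C⋆-algebra of the compact operators on the Hilbert space `H`. -/
def compactOperators : NonUnitalStarSubalgebra ℂ (H →L[ℂ] H) where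
  carrier := {T | IsCompactOperator T}
  zero_mem' := isCompactOperator_zero
  add_mem' hS hT := hS.add hT
  mul_mem' {S _} _ hT := hT.clm_comp S
  smul_mem' c _ hT := hT.smul c
  star_mem' hT := isCompactOperator_star H hT

instance isClosed_compactOperators : IsClosed (compactOperators H : Set (H →L[ℂ] H)) :=
  isClosed_setOfPred_isCompactOperator

end CompactOperators

/-! ### Direct sums of C⋆-algebras -/

section DirectSum

variable {T : Type*} (K : T → Type*) [∀ t, NonUnitalCStarAlgebra (K t)]

/-- The direct sum of a family of C⋆-algebras: all families `(x t)` with `x t` in `K t` for which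
`{t | ε ≤ ‖x t‖}` is finite for every `ε > 0`, with the operations of the product and the supremum
norm. -/
def cstarDirectSum : NonUnitalStarSubalgebra ℂ (lp K ∞) where
  carrier := {x | ∀ ε : ℝ, 0 < ε → {t | ε ≤ ‖x t‖}.Finite}
  zero_mem' ε hε := by
    refine Set.finite_empty.subset fun t ht => ?_
    have h : ε ≤ ‖(0 : K t)‖ := ht
    rw [norm_zero] at h
    exact absurd h hε.not_ge
  add_mem' {x y} hx hy ε hε := by
    refine ((hx (ε / 2) (by positivity)).union (hy (ε / 2) (by positivity))).subset fun t ht => ?_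
    have h : ε ≤ ‖x t + y t‖ := ht
    by_contra hc
    have hc' : ¬ (ε / 2 ≤ ‖x t‖ ∨ ε / 2 ≤ ‖y t‖) := hc
    push Not at hc'
    linarith [norm_add_le (x t) (y t)]
  mul_mem' {x y} hx _ ε hε := by
    have hp : 0 < ‖y‖ + 1 := by positivity
    refine (hx (ε / (‖y‖ + 1)) (by positivity)).subset fun t ht => ?_
    have h : ε ≤ ‖x t * y t‖ := ht
    have h2 : ‖y t‖ ≤ ‖y‖ := lp.norm_apply_le_norm ENNReal.top_ne_zero y t
    refine (div_le_iff₀ hp).2 ?_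
    nlinarith [norm_mul_le (x t) (y t), norm_nonneg (x t), norm_nonneg (y t)]
  smul_mem' c x hx ε hε := by
    have hp : 0 < ‖c‖ + 1 := by positivity
    refine (hx (ε / (‖c‖ + 1)) (by positivity)).subset fun t ht => ?_
    have h : ε ≤ ‖c • x t‖ := ht
    rw [norm_smul] at h
    refine (div_le_iff₀ hp).2 ?_
    nlinarith [norm_nonneg (x t)]
  star_mem' {x} hx ε hε := by
    refine (hx ε hε).subset fun t ht => ?_
    have h : ε ≤ ‖star (x t)‖ := ht
    rwa [norm_star] at h

instance isClosed_cstarDirectSum : IsClosed (cstarDirectSum K : Set (lp K ∞)) := by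
  refine isClosed_of_closure_subset fun x hx ε hε => ?_
  obtain ⟨y, hy, hxy⟩ := Metric.mem_closure_iff.1 hx (ε / 2) (by positivity)
  refine (hy (ε / 2) (by positivity)).subset fun t ht => ?_
  have h : ε ≤ ‖x t‖ := ht
  have h1 : ‖x t - y t‖ ≤ ‖x - y‖ := lp.norm_apply_le_norm ENNReal.top_ne_zero (x - y) t
  rw [dist_eq_norm] at hxy
  have h2 := norm_sub_norm_le (x t) (y t)
  change ε / 2 ≤ ‖y t‖
  linarith

end DirectSum

/-! ### Elementary and dual C⋆-algebras -/

/-- A C⋆-algebra is *elementary* if it is ⋆-isomorphic to the algebra of the compact operators on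
some (complex) Hilbert space. A Hilbert space whose compact operators are isomorphic to `B` embeds
into `B`, so it can always be taken in the universe of `B`. -/
def IsElementary.{u} (B : Type u) [NonUnitalCStarAlgebra B] : Prop :=
  ∃ (H : Type u) (_ : NormedAddCommGroup H) (_ : InnerProductSpace ℂ H) (_ : CompleteSpace H),
    Nonempty (B ≃⋆ₐ[ℂ] compactOperators H)

/-- A C⋆-algebra is *dual* if it is ⋆-isomorphic to a direct sum of elementary C⋆-algebras. Up to
isomorphism, the index set of the non-zero summands and the summands themselves can always be taken
in the universe of `B`. The empty direct sum, the zero algebra, is dual. -/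
def IsDualAlgebra.{u} (B : Type u) [NonUnitalCStarAlgebra B] : Prop :=
  ∃ (T : Type u) (K : T → Type u) (_ : ∀ t, NonUnitalCStarAlgebra (K t)),
    (∀ t, IsElementary (K t)) ∧ Nonempty (B ≃⋆ₐ[ℂ] cstarDirectSum K)

end

/-! ### Approximation of compact operators by operators of finite rank -/

/-! Each element `k` of algebraic rank one satisfies `k = k p`, where the minimal projection `p` is
a multiple of `k* k`, so `C(A)` is the closed ideal generated by the minimal projections. For such a
`p` one has `p A p = ℂ p`, hence `x* y ∈ ℂ p` for `x, y ∈ A p`; this scalar makes the left ideal `A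
p` a Hilbert space on which `A` acts by left multiplication, with `x y*` acting as the rank-one
operator of `x` and `y` (`rep_mul_star`).

Call `p` and `q` equivalent if `p A q ≠ 0`; then `q = c v v*` with `v ∈ A p`. Choose one projection
from each class. A minimal projection acts with rank one on the space of its own class and as zero
on the other chosen spaces. Compactness and decay of the components are closed ideal conditions, so
they pass to all of `C(A)`. This gives a homomorphism from `C(A)` to the direct sum of the `K(A p)`.
It is injective by `eq_zero_of_rep_eq_zero`, hence isometric with closed range, and it is surjective
because the elements `x y*` supply all rank-one operators in each summand (`exists_rep_eq`). -/

/-- Compact operators between Hilbert spaces are limits of operators of finite rank. -/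
theorem IsCompactOperator.mem_closure_span_rankOne {H : Type*} [NormedAddCommGroup H]
    [InnerProductSpace ℂ H] [CompleteSpace H] {T : H →L[ℂ] H} (hT : IsCompactOperator T) :
    T ∈ closure (Submodule.span ℂ
      {S : H →L[ℂ] H | ∃ x y, S = InnerProductSpace.rankOne ℂ x y} : Set (H →L[ℂ] H)) := by
  rw [Metric.mem_closure_iff]
  intro ε hε
  obtain ⟨K, hK, hKs⟩ := IsCompactOperator.image_closedBall_subset_compact
    (f := (T : H →ₗ[ℂ] H)) hT 1
  obtain ⟨t, htf, htc⟩ := Metric.totallyBounded_iff.1 (hK.totallyBounded.subset hKs) (ε / 2)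
    (by positivity)
  -- The approximant is `T` followed by the projection onto the span of a finite `ε / 2`-net of the
  -- image of the unit ball.
  let U : Submodule ℂ H := Submodule.span ℂ t
  have : FiniteDimensional ℂ U := FiniteDimensional.span_of_finite ℂ htf
  refine ⟨U.starProjection ∘L T, ?_, ?_⟩
  · rw [(stdOrthonormalBasis ℂ U).starProjection_eq_sum_rankOne,
      ContinuousLinearMap.finsetSum_comp]
    refine Submodule.sum_mem _ fun i _ => Submodule.subset_span ?_
    rw [InnerProductSpace.rankOne_comp]
    exact ⟨_, _, rfl⟩
  · rw [dist_eq_norm]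
    refine lt_of_le_of_lt (ContinuousLinearMap.opNorm_le_of_unit_norm (C := ε / 2)
      (by positivity) fun z hz => ?_) (half_lt_self hε)
    obtain ⟨u, hu, hzu⟩ := Set.mem_iUnion₂.1
      (htc ⟨z, by simp [hz], rfl⟩)
    have hmin := U.starProjection_minimal (T z)
    have h1 : ‖T z - U.starProjection (T z)‖ ≤ ‖T z - u‖ := by
      rw [hmin]
      exact ciInf_le ⟨0, by rintro _ ⟨w, rfl⟩; exact norm_nonneg _⟩
        (⟨u, Submodule.subset_span hu⟩ : U)
    rw [Metric.mem_ball, dist_eq_norm] at hzu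
    exact h1.trans hzu.le

/-! ### Minimal projections -/

section MinimalProjection

variable {A : Type*} [CStarAlgebra A]

/-- A minimal projection of `A`: a projection of algebraic rank one. -/
def IsMinimalProjection (p : A) : Prop :=
  IsStarProjection p ∧ IsAlgebraicRankOne p

/-- The right support of an element `k` of algebraic rank one, which is a multiple of `k* k`, is a
minimal projection. -/
theorem exists_isMinimalProjection_mul_eq {k : A} (hk : IsAlgebraicRankOne k) :
    ∃ p, IsMinimalProjection p ∧ k * p = k := by
  have h0 : star k * k ≠ 0 := (CStarRing.star_mul_self_ne_zero_iff k).2 hk.1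
  have hcorner : ∀ a, ∃ α : ℂ, (star k * k) * a * (star k * k) = α • (star k * k) := fun a => by
    obtain ⟨α, hα⟩ := hk.2 (a * star k)
    refine ⟨α, ?_⟩
    rw [← mul_smul_comm, ← hα]
    simp only [mul_assoc]
  -- Taking `a = 1` gives `(k* k)² = l k* k`, so `l⁻¹ k* k` is the projection sought.
  obtain ⟨l, hl⟩ := hcorner 1
  rw [mul_one] at hl
  have hl0 : l ≠ 0 := by
    rintro rfl
    rw [zero_smul] at hl
    have : star (star k * k) * (star k * k) = 0 := by simpa [mul_assoc] using hl
    exact h0 ((CStarRing.star_mul_self_eq_zero_iff _).1 this)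
  have hls : star l = l := by
    have h := congrArg star hl
    simp only [star_mul, star_star, star_smul] at h
    rw [hl] at h
    exact (smul_left_injective ℂ h0 h).symm
  have hidem : (l⁻¹ • (star k * k)) * (l⁻¹ • (star k * k)) = l⁻¹ • (star k * k) := by
    rw [smul_mul_smul_comm, hl, smul_smul, inv_mul_cancel_right₀ hl0]
  have hsa : star (l⁻¹ • (star k * k)) = l⁻¹ • (star k * k) := by
    rw [star_smul, star_inv₀, hls, star_mul, star_star]
  refine ⟨l⁻¹ • (star k * k),
    ⟨⟨hidem, hsa⟩, smul_ne_zero (inv_ne_zero hl0) h0, fun a => ?_⟩, ?_⟩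
  · obtain ⟨α, hα⟩ := hcorner a
    refine ⟨l⁻¹ * α, ?_⟩
    rw [smul_mul_assoc, smul_mul_assoc, mul_smul_comm, hα, smul_comm l⁻¹ α, smul_smul, smul_smul]
  · set p := l⁻¹ • (star k * k) with hp
    have hkp : star k * k = l • p := by rw [hp, smul_smul, mul_inv_cancel₀ hl0, one_smul]
    have h : star (k * p - k) * (k * p - k) = 0 := by
      have h1 : star (k * p - k) * (k * p - k) = (p - 1) * (star k * k) * (p - 1) := by
        simp only [star_sub, star_mul, hsa]
        noncomm_ring
      rw [h1, hkp, mul_smul_comm, sub_mul, one_mul, hidem, sub_self, smul_zero, zero_mul]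
    exact sub_eq_zero.1 ((CStarRing.star_mul_self_eq_zero_iff _).1 h)

namespace IsMinimalProjection

variable {p q : A}

theorem mul_self (hp : IsMinimalProjection p) : p * p = p := hp.1.1

theorem star_eq (hp : IsMinimalProjection p) : star p = p := hp.1.2

theorem ne_zero (hp : IsMinimalProjection p) : p ≠ 0 := hp.2.1

theorem eq_zero_of_corner (hp : IsMinimalProjection p) (hq : IsMinimalProjection q)
    (h : ∀ a, p * a * q = 0) (a : A) : q * a * p = 0 := by
  have := congrArg star (h (star a))
  simpa [hp.star_eq, hq.star_eq, mul_assoc] using this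

/-- If the corner `p A q` is non-zero, then the minimal projection `q` is equivalent to `p`. -/
theorem exists_eq_smul_mul_star (hp : IsMinimalProjection p) (hq : IsMinimalProjection q)
    {a : A} (ha : p * a * q ≠ 0) :
    ∃ (v : A) (c : ℂ), v * p = v ∧ q = c • (v * star v) := by
  -- The witness is `v = (p a q)*`, for which `v v* = q a* p a q` lies in `q A q = ℂ q`.
  obtain ⟨α, hα⟩ := hq.2.2 (star a * p * a)
  have hv : star (p * a * q) * (p * a * q) = α • q := by
    rw [← hα]
    simp only [star_mul, hp.star_eq, hq.star_eq]
    calc q * (star a * p) * (p * a * q) = q * (star a * (p * p) * a) * q := by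
          simp only [mul_assoc]
      _ = _ := by rw [hp.mul_self]
  have hα0 : α ≠ 0 := by
    rintro rfl
    rw [zero_smul] at hv
    exact ha ((CStarRing.star_mul_self_eq_zero_iff _).1 hv)
  refine ⟨star (p * a * q), α⁻¹, ?_, ?_⟩
  · simp only [star_mul, hp.star_eq, mul_assoc, hp.mul_self]
  · rw [star_star, hv, smul_smul, inv_mul_cancel₀ hα0, one_smul]

end IsMinimalProjection

end MinimalProjection

/-! ### The representation on the left ideal of a minimal projection -/

section Representation

variable {A : Type*} [CStarAlgebra A]

variable (A) in
/-- The type of minimal projections of `A`. -/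
abbrev MinimalProjection : Type _ := {p : A // IsMinimalProjection p}

namespace MinimalProjection

variable (p : MinimalProjection A)

/-- The closed left ideal `A p` as a submodule of `A`. -/
def leftIdealSubmodule : Submodule ℂ A where
  carrier := {x | x * p = x}
  zero_mem' := zero_mul _
  add_mem' {x y} hx hy := by
    rw [Set.mem_ofPred_eq] at *
    rw [add_mul, hx, hy]
  smul_mem' c x hx := by
    rw [Set.mem_ofPred_eq] at *
    rw [smul_mul_assoc, hx]

/-- The left ideal `A p` as a type, which carries the structure of a Hilbert space. -/
def leftIdeal : Type _ := leftIdealSubmodule p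

noncomputable instance : NormedAddCommGroup (leftIdeal p) :=
  inferInstanceAs (NormedAddCommGroup (leftIdealSubmodule p))

noncomputable instance : NormedSpace ℂ (leftIdeal p) :=
  inferInstanceAs (NormedSpace ℂ (leftIdealSubmodule p))

namespace leftIdeal

variable {p}

/-- The inclusion of `A p` into `A`. -/
def val (x : leftIdeal p) : A := Subtype.val x

instance : CoeOut (leftIdeal p) A := ⟨val⟩

/-- The element of `A p` given by `x` with `x p = x`. -/
def mk (x : A) (hx : x * p = x) : leftIdeal p := ⟨x, hx⟩

@[simp] theorem coe_mk (x : A) (hx : x * p = x) : (mk x hx : A) = x := rfl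

@[ext] theorem ext {x y : leftIdeal p} (h : (x : A) = y) : x = y := Subtype.ext h

@[simp] theorem coe_zero : ((0 : leftIdeal p) : A) = 0 := rfl

@[simp] theorem coe_add (x y : leftIdeal p) : ((x + y : leftIdeal p) : A) = x + y := rfl

@[simp] theorem coe_smul (c : ℂ) (x : leftIdeal p) : ((c • x : leftIdeal p) : A) = c • (x : A) :=
  rfl

theorem norm_coe (x : leftIdeal p) : ‖(x : A)‖ = ‖x‖ := rfl

end leftIdeal

theorem coe_mul_self (x : leftIdeal p) : (x : A) * p = x := x.2

theorem mul_star_coe (x : leftIdeal p) : (p : A) * star (x : A) = star (x : A) := by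
  have := congrArg star (coe_mul_self p x)
  rwa [star_mul, p.2.star_eq] at this

instance : CompleteSpace (leftIdeal p) := by
  have : IsClosed (leftIdealSubmodule p : Set A) :=
    isClosed_eq (continuous_id.mul continuous_const) continuous_id
  exact this.completeSpace_coe

/-- Since `x = x p` and `y = y p`, the product `x* y = p x* y p` lies in the corner `p A p = ℂ p`.
-/
theorem exists_star_mul_eq (x y : leftIdeal p) : ∃ α : ℂ, star (x : A) * y = α • (p : A) := by
  obtain ⟨α, hα⟩ := p.2.2.2 (star (x : A) * y)
  refine ⟨α, ?_⟩
  rw [← hα, ← mul_assoc, mul_star_coe, mul_assoc, coe_mul_self]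

/-- The inner product of `x` and `y` in `A p` is the scalar `α` with `x* y = α p`. -/
noncomputable instance : Inner ℂ (leftIdeal p) :=
  ⟨fun x y => (exists_star_mul_eq p x y).choose⟩

theorem star_mul_eq (x y : leftIdeal p) : star (x : A) * y = ⟪x, y⟫_ℂ • (p : A) :=
  (exists_star_mul_eq p x y).choose_spec

theorem eq_of_smul_eq {α β : ℂ} (h : α • (p : A) = β • (p : A)) : α = β :=
  smul_left_injective ℂ p.2.ne_zero h

theorem norm_coe : ‖(p : A)‖ = 1 := by
  have h := CStarRing.norm_star_mul_self (x := (p : A))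
  rw [p.2.star_eq, p.2.mul_self] at h
  have h0 : ‖(p : A)‖ ≠ 0 := norm_ne_zero_iff.2 p.2.ne_zero
  exact (mul_left_cancel₀ h0 (by rw [mul_one]; exact h)).symm

/-- The C⋆-identity gives `|α| = ‖x‖²`, and positivity of `x* x` and `p` fixes the sign. Thus the
inner product induces the norm inherited from `A`. -/
theorem eq_norm_sq_of_star_mul_self (x : leftIdeal p) {α : ℂ}
    (h : star (x : A) * x = α • (p : A)) : α = (‖x‖ : ℂ) ^ 2 := by
  have hreal : star α = α := by
    have h' := congrArg star h
    rw [star_mul, star_star, star_smul, p.2.star_eq, h] at h'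
    exact (eq_of_smul_eq p h').symm
  obtain ⟨r, rfl⟩ := Complex.conj_eq_iff_real.1 hreal
  have hnorm : ‖x‖ ^ 2 = |r| := by
    have := CStarRing.norm_star_mul_self (x := (x : A))
    rw [h, norm_smul, norm_coe, mul_one, Complex.norm_real, Real.norm_eq_abs] at this
    rw [sq, this, leftIdeal.norm_coe]
  suffices hr : 0 ≤ r by
    rw [← Complex.ofReal_pow, hnorm, abs_of_nonneg hr]
  by_contra! hr
  let _ := CStarAlgebra.spectralOrder A
  have := CStarAlgebra.spectralOrderedRing A
  have hp0 : 0 ≤ (p : A) := p.2.1.nonneg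
  have h1 : 0 ≤ (-r) • (p : A) := smul_nonneg (by linarith) hp0
  have h2 : 0 ≤ -((-r) • (p : A)) := by
    rw [neg_smul, neg_neg, ← Complex.coe_smul, ← h]
    exact star_mul_self_nonneg _
  have h3 : (-r) • (p : A) = 0 := le_antisymm (neg_nonneg.1 h2) h1
  exact (smul_ne_zero (by linarith) p.2.ne_zero) h3

noncomputable instance : InnerProductSpace ℂ (leftIdeal p) where
  norm_sq_eq_re_inner x := by
    rw [eq_norm_sq_of_star_mul_self p x (star_mul_eq p x x), ← Complex.ofReal_pow]
    exact (Complex.ofReal_re _).symm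
  conj_inner_symm x y := by
    apply eq_of_smul_eq p
    rw [← star_mul_eq, ← star_star ((x : A)), ← star_star (y : A), ← star_mul, star_star,
      star_mul_eq, star_smul, p.2.star_eq]
    rfl
  add_left x y z := by
    apply eq_of_smul_eq p
    rw [add_smul, ← star_mul_eq, ← star_mul_eq, ← star_mul_eq, leftIdeal.coe_add, star_add, add_mul]
  smul_left x y r := by
    apply eq_of_smul_eq p
    rw [mul_smul, ← star_mul_eq, ← star_mul_eq, leftIdeal.coe_smul, star_smul, smul_mul_assoc]
    rfl

/-- Left multiplication by `a` on `A p`. -/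
noncomputable def mulLeft (a : A) : leftIdeal p →L[ℂ] leftIdeal p :=
  LinearMap.mkContinuous
    { toFun := fun x => leftIdeal.mk (a * x) (by rw [mul_assoc, coe_mul_self])
      map_add' := fun x y => leftIdeal.ext (mul_add a x y)
      map_smul' := fun c x => leftIdeal.ext (mul_smul_comm c a (x : A)) }
    ‖a‖ fun x => norm_mul_le a x

@[simp] theorem coe_mulLeft (a : A) (x : leftIdeal p) : (mulLeft p a x : A) = a * x := rfl

theorem norm_mulLeft_le (a : A) : ‖mulLeft p a‖ ≤ ‖a‖ :=
  LinearMap.mkContinuous_norm_le _ (norm_nonneg a) _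

/-- The representation of `A` on `A p` by left multiplication. -/
noncomputable def rep : A →⋆ₙₐ[ℂ] (leftIdeal p →L[ℂ] leftIdeal p) where
  toFun := mulLeft p
  map_smul' c a := by ext x; simp
  map_zero' := by ext x; simp
  map_add' a b := by ext x; simp [add_mul]
  map_mul' a b := by ext x; simp [mul_assoc]
  map_star' a := by
    rw [ContinuousLinearMap.star_eq_adjoint, ContinuousLinearMap.eq_adjoint_iff]
    intro x y
    apply eq_of_smul_eq p
    rw [← star_mul_eq, ← star_mul_eq]
    simp [mul_assoc]

@[simp] theorem coe_rep (a : A) (x : leftIdeal p) : (rep p a x : A) = a * x := rfl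

theorem norm_rep_le (a : A) : ‖rep p a‖ ≤ ‖a‖ := norm_mulLeft_le p a

theorem continuous_rep : Continuous (rep p) :=
  AddMonoidHomClass.continuous_of_bound (rep p) 1 fun a => by
    rw [one_mul]
    exact norm_rep_le p a

theorem rep_mul_star (x y : leftIdeal p) :
    rep p ((x : A) * star (y : A)) = InnerProductSpace.rankOne ℂ x y := by
  ext z
  rw [coe_rep, mul_assoc, star_mul_eq, mul_smul_comm, coe_mul_self, InnerProductSpace.rankOne_apply]
  rfl

theorem isCompactOperator_rankOne (x y : leftIdeal p) :
    IsCompactOperator (InnerProductSpace.rankOne ℂ x y : leftIdeal p →L[ℂ] leftIdeal p) := by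
  rw [InnerProductSpace.rankOne_def']
  have h : IsCompactOperator (id : ℂ → ℂ) :=
    (isCompactOperator_id_iff_finiteDimensional (𝕜 := ℂ)).2 inferInstance
  exact (h.comp_clm (innerSL ℂ y)).clm_comp (ContinuousLinearMap.toSpanSingleton ℂ x)

variable {p} {q : A}

theorem rep_eq_zero_of_corner (h : ∀ a, q * a * (p : A) = 0) : rep p q = 0 := by
  ext x
  rw [coe_rep, ← coe_mul_self, ← mul_assoc, h]
  rfl

variable (p) in
-- Either `q` annihilates `A p`, or `q = c v v*` with `v ∈ A p` acts as a multiple of a rank-one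
-- operator.
theorem isCompactOperator_rep_of_isMinimalProjection (hq : IsMinimalProjection q) :
    IsCompactOperator (rep p q) := by
  by_cases h : ∀ a, (p : A) * a * q = 0
  · rw [rep_eq_zero_of_corner (p.2.eq_zero_of_corner hq h)]
    exact isCompactOperator_zero
  · push Not at h
    obtain ⟨a, ha⟩ := h
    obtain ⟨v, c, hvp, hv⟩ := p.2.exists_eq_smul_mul_star hq ha
    have hc : IsCompactOperator (rep p (v * star v)) := by
      have h := rep_mul_star p (.mk v hvp) (.mk v hvp)
      rw [leftIdeal.coe_mk] at h
      rw [h]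
      exact isCompactOperator_rankOne p _ _
    have hq' : rep p q = c • rep p (v * star v) := by
      rw [← map_smul, ← hv]
    rw [hq']
    exact IsCompactOperator.smul (f := rep p (v * star v)) hc c

/-- A set of minimal projections that contains exactly one member of each equivalence class. -/
structure IsTransversal (S : Set (MinimalProjection A)) : Prop where
  corner_eq_zero : S.Pairwise fun p q => ∀ a, (p : A) * a * q = 0
  exists_corner_ne_zero : ∀ q : MinimalProjection A, ∃ p ∈ S, ∃ a, (p : A) * a * q ≠ 0

variable (A) in
theorem exists_isTransversal : ∃ S : Set (MinimalProjection A), IsTransversal S := by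
  obtain ⟨S, hS⟩ := zorn_subset
    {S : Set (MinimalProjection A) | S.Pairwise fun p q => ∀ a, (p : A) * a * q = 0}
    fun c hc hchain => ⟨⋃₀ c, (Set.pairwise_sUnion hchain.directedOn).2 fun s hs => hc hs,
      fun s hs => Set.subset_sUnion_of_mem hs⟩
  refine ⟨S, hS.prop, fun q => ?_⟩
  by_contra! h
  -- If every corner `p A q` with `p ∈ S` vanished, maximality would force `q ∈ S`, yet `q 1 q = q ≠
  -- 0`.
  have hqS : q ∈ S :=
    hS.le_of_ge (y := insert q S)
      (hS.prop.insert fun p hp _ => ⟨p.2.eq_zero_of_corner q.2 (h p hp), h p hp⟩)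
      (Set.subset_insert q S) (Set.mem_insert q S)
  have := h q hqS 1
  rw [mul_one, q.2.mul_self] at this
  exact q.2.ne_zero this

end MinimalProjection

end Representation

/-! ### Homomorphisms into direct sums -/

section DirectSumHom

variable {B T : Type*} [NonUnitalCStarAlgebra B] {K : T → Type*} [∀ t, NonUnitalCStarAlgebra (K t)]

/-- The homomorphism into a direct sum of C⋆-algebras with given components. -/
noncomputable def cstarDirectSumLift (φ : ∀ t, B →⋆ₙₐ[ℂ] K t) (hφ : ∀ t x, ‖φ t x‖ ≤ ‖x‖)
    (hfin : ∀ x, ∀ ε : ℝ, 0 < ε → {t | ε ≤ ‖φ t x‖}.Finite) : B →⋆ₙₐ[ℂ] cstarDirectSum K where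
  toFun x := ⟨⟨fun t => φ t x, memℓp_infty ⟨‖x‖, by
      rintro _ ⟨t, rfl⟩
      exact hφ t x⟩⟩, hfin x⟩
  map_smul' c x := Subtype.ext <| lp.ext <| funext fun t => map_smul (φ t) c x
  map_zero' := Subtype.ext <| lp.ext <| funext fun t => map_zero (φ t)
  map_add' x y := Subtype.ext <| lp.ext <| funext fun t => map_add (φ t) x y
  map_mul' x y := Subtype.ext <| lp.ext <| funext fun t => map_mul (φ t) x y
  map_star' x := Subtype.ext <| lp.ext <| funext fun t => map_star (φ t) x

variable {φ : ∀ t, B →⋆ₙₐ[ℂ] K t} {hφ : ∀ t x, ‖φ t x‖ ≤ ‖x‖}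
  {hfin : ∀ x, ∀ ε : ℝ, 0 < ε → {t | ε ≤ ‖φ t x‖}.Finite}

theorem cstarDirectSumLift_apply (x : B) (t : T) :
    (cstarDirectSumLift φ hφ hfin x).1 t = φ t x := rfl

theorem injective_cstarDirectSumLift (h : ∀ x, (∀ t, φ t x = 0) → x = 0) :
    Function.Injective (cstarDirectSumLift φ hφ hfin) := by
  refine (injective_iff_map_eq_zero _).2 fun x hx => h x fun t => ?_
  rw [← cstarDirectSumLift_apply (hφ := hφ) (hfin := hfin), hx]
  rfl

/-- An element on which all but one of the components vanish has the norm of that component. -/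
theorem norm_eq_norm_component (hφ : ∀ t x, ‖φ t x‖ ≤ ‖x‖)
    (hfin : ∀ x, ∀ ε : ℝ, 0 < ε → {t | ε ≤ ‖φ t x‖}.Finite)
    (h : ∀ x, (∀ t, φ t x = 0) → x = 0) {x : B} {t : T}
    (hx : ∀ s, s ≠ t → φ s x = 0) : ‖φ t x‖ = ‖x‖ := by
  refine le_antisymm (hφ t x) ?_
  -- An injective ⋆-homomorphism of C⋆-algebras is isometric, and the norm of the direct sum is the
  -- supremum over the components.
  rw [← NonUnitalStarAlgHom.norm_map _ (injective_cstarDirectSumLift (hφ := hφ) (hfin := hfin) h) x]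
  refine lp.norm_le_of_forall_le (norm_nonneg _) fun s => ?_
  change ‖φ s x‖ ≤ ‖φ t x‖
  by_cases hs : s = t
  · rw [hs]
  · rw [hx s hs, norm_zero]
    exact norm_nonneg _

/-- The range is closed because the map is isometric, and dense because it contains every truncation
of a family to finitely many components. -/
theorem surjective_cstarDirectSumLift (h : ∀ x, (∀ t, φ t x = 0) → x = 0)
    (hsurj : ∀ t k, ∃ x, φ t x = k ∧ ∀ s, s ≠ t → φ s x = 0) :
    Function.Surjective (cstarDirectSumLift φ hφ hfin) := by
  classical
  intro y
  have hclosed : IsClosed (Set.range (cstarDirectSumLift φ hφ hfin)) :=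
    (NonUnitalStarAlgHom.isometry _ (injective_cstarDirectSumLift h)).isClosedEmbedding.isClosed_range
  refine hclosed.closure_subset (Metric.mem_closure_iff.2 fun ε hε => ?_)
  have hfin' : {t | ε / 2 ≤ ‖y.1 t‖}.Finite := y.2 (ε / 2) (by positivity)
  choose x hx hx0 using fun t => hsurj t (y.1 t)
  refine ⟨_, ⟨∑ t ∈ hfin'.toFinset, x t, rfl⟩, ?_⟩
  rw [dist_eq_norm]
  refine lt_of_le_of_lt (lp.norm_le_of_forall_le (by positivity) fun s => ?_) (half_lt_self hε)
  change ‖y.1 s - φ s (∑ t ∈ hfin'.toFinset, x t)‖ ≤ ε / 2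
  have hs : φ s (∑ t ∈ hfin'.toFinset, x t) = if s ∈ hfin'.toFinset then y.1 s else 0 := by
    rw [map_sum, ← Finset.sum_ite_eq hfin'.toFinset s fun _ => y.1 s]
    refine Finset.sum_congr rfl fun t _ => ?_
    split_ifs with hst
    · subst hst
      exact hx s
    · exact hx0 t s hst
  rw [hs]
  split_ifs with hmem
  · rw [sub_self, norm_zero]
    positivity
  · rw [sub_zero]
    rw [Set.Finite.mem_toFinset, Set.mem_ofPred_eq, not_le] at hmem
    exact hmem.le

end DirectSumHom

/-! ### The ideal `C(A)` as a direct sum of algebras of compact operators -/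

section DualAlgebra

variable {A : Type*} [CStarAlgebra A]

theorem IsAlgebraicRankOne.mem_algebraicallyCompactIdeal {k : A} (hk : IsAlgebraicRankOne k) :
    k ∈ algebraicallyCompactIdeal A :=
  _root_.mem_algebraicallyCompactIdeal.2 fun _ _ h => h k hk

/-- The ideal generated by the elements of algebraic rank one is the smallest closed ideal that
contains the minimal projections. -/
theorem algebraicallyCompactIdeal_induction {P : A → Prop} (closed : IsClosed {x | P x})
    (zero : P 0) (add : ∀ x y, P x → P y → P (x + y)) (mul_left : ∀ a x, P x → P (a * x))
    (mul_right : ∀ x a, P x → P (x * a)) (minimal : ∀ q, IsMinimalProjection q → P q)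
    {x : A} (hx : x ∈ algebraicallyCompactIdeal A) : P x := by
  let J : TwoSidedIdeal A := TwoSidedIdeal.mk' {y : A | P y} zero
    (fun {y z} hy hz => add y z hy hz)
    (fun {y} hy => by simpa using mul_left (-1) y hy)
    (fun {y z} hz => mul_left y z hz)
    (fun {y z} hy => mul_right y z hy)
  have hJ : (J : Set A) = {y : A | P y} := TwoSidedIdeal.coe_mk' ..
  have hxJ : x ∈ J := mem_algebraicallyCompactIdeal.1 hx J (hJ ▸ closed) fun k hk => by
    obtain ⟨q, hq, hkq⟩ := exists_isMinimalProjection_mul_eq hk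
    rw [← SetLike.mem_coe, hJ, ← hkq]
    exact mul_left k q (minimal q hq)
  rwa [← SetLike.mem_coe, hJ] at hxJ

namespace MinimalProjection

theorem isCompactOperator_rep (p : MinimalProjection A) {x : A}
    (hx : x ∈ algebraicallyCompactIdeal A) : IsCompactOperator (rep p x) := by
  refine algebraicallyCompactIdeal_induction (P := fun x => IsCompactOperator (rep p x))
    ?_ ?_ ?_ ?_ ?_ (fun q hq => isCompactOperator_rep_of_isMinimalProjection p hq) hx
  · exact (isClosed_compactOperators (leftIdeal p)).preimage (continuous_rep p)
  · rw [map_zero]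
    exact isCompactOperator_zero
  · intro x y hx hy
    rw [map_add]
    exact hx.add hy
  · intro a x hx
    rw [map_mul]
    exact IsCompactOperator.clm_comp hx (rep p a)
  · intro x a hx
    rw [map_mul]
    exact IsCompactOperator.comp_clm hx (rep p a)

namespace IsTransversal

variable {S : Set (MinimalProjection A)}

/-- The elements whose components tend to zero form a closed ideal, and a minimal projection has
only one non-zero component. -/
theorem finite_le_norm_rep (hS : IsTransversal S) {x : A}
    (hx : x ∈ algebraicallyCompactIdeal A) {ε : ℝ} (hε : 0 < ε) :
    {p : S | ε ≤ ‖rep p.1 x‖}.Finite := by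
  have hmul : ∀ (C : ℝ) (x y : A), (∀ p : S, ‖rep p.1 y‖ ≤ C * ‖rep p.1 x‖) →
      (∀ ε : ℝ, 0 < ε → {p : S | ε ≤ ‖rep p.1 x‖}.Finite) →
      ∀ ε : ℝ, 0 < ε → {p : S | ε ≤ ‖rep p.1 y‖}.Finite := by
    intro C x y h hx ε hε
    refine (hx (ε / (|C| + 1)) (by positivity)).subset fun p hp => ?_
    have hp : ε ≤ ‖rep p.1 y‖ := hp
    have hC : 0 < |C| + 1 := by positivity
    refine (div_le_iff₀ hC).2 ?_
    nlinarith [h p, le_abs_self C, norm_nonneg (rep p.1 x)]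
  refine algebraicallyCompactIdeal_induction
    (P := fun x => ∀ ε : ℝ, 0 < ε → {p : S | ε ≤ ‖rep p.1 x‖}.Finite) ?_ ?_ ?_ ?_ ?_ ?_ hx ε hε
  · refine isClosed_of_closure_subset fun x hx ε hε => ?_
    obtain ⟨y, hy, hxy⟩ := Metric.mem_closure_iff.1 hx (ε / 2) (by positivity)
    refine (hy (ε / 2) (by positivity)).subset fun p hp => ?_
    have hp : ε ≤ ‖rep p.1 x‖ := hp
    have h1 := norm_rep_le p.1 (x - y)
    rw [map_sub] at h1
    rw [dist_eq_norm] at hxy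
    have h2 := norm_sub_norm_le (rep p.1 x) (rep p.1 y)
    change ε / 2 ≤ ‖rep p.1 y‖
    linarith
  · intro ε hε
    simp [hε.not_ge]
  · intro x y hx hy ε hε
    refine ((hx (ε / 2) (by positivity)).union (hy (ε / 2) (by positivity))).subset fun p hp => ?_
    have hp : ε ≤ ‖rep p.1 (x + y)‖ := hp
    rw [map_add] at hp
    by_contra hc
    have hc' : ¬ (ε / 2 ≤ ‖rep p.1 x‖ ∨ ε / 2 ≤ ‖rep p.1 y‖) := hc
    push Not at hc'
    linarith [norm_add_le (rep p.1 x) (rep p.1 y)]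
  · refine fun a x => hmul ‖a‖ x _ fun p => ?_
    rw [map_mul]
    exact (norm_mul_le _ _).trans (by gcongr; exact norm_rep_le _ _)
  · refine fun x a => hmul ‖a‖ x _ fun p => ?_
    rw [map_mul, mul_comm ‖a‖]
    exact (norm_mul_le _ _).trans (by gcongr; exact norm_rep_le _ _)
  · intro q hq ε hε
    obtain ⟨p, hp, a, ha⟩ := hS.exists_corner_ne_zero ⟨q, hq⟩
    obtain ⟨v, c, hvp, hv⟩ := p.2.exists_eq_smul_mul_star hq ha
    refine (Set.finite_singleton (⟨p, hp⟩ : S)).subset fun r hr => ?_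
    by_contra hrp
    have hr : ε ≤ ‖rep r.1 q‖ := hr
    rw [rep_eq_zero_of_corner, norm_zero] at hr
    · exact hr.not_gt hε
    · intro b
      -- For `r ≠ p` in `S`, `q b r = c v (p v* b r)` vanishes because `p A r = 0`.
      have hvs : star v = p * star v := by
        rw [← hvp, star_mul, p.2.star_eq, ← mul_assoc, p.2.mul_self]
      have h0 := hS.corner_eq_zero hp r.2 (fun h => hrp (Subtype.ext h.symm)) (star v * b)
      rw [hv, hvs, smul_mul_assoc, smul_mul_assoc]
      simp only [mul_assoc] at h0 ⊢
      rw [h0, mul_zero, smul_zero]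

/-- The elements `y` with `x A y = 0` form a closed ideal. It contains each minimal projection `c v
v*`, since `x` kills `a v ∈ A p`; hence it contains `x*`, and `x x* = 0`. -/
theorem eq_zero_of_rep_eq_zero (hS : IsTransversal S) {x : A} (hx : x ∈ algebraicallyCompactIdeal A)
    (h : ∀ p ∈ S, rep p x = 0) : x = 0 := by
  have key : ∀ a, x * a * star x = 0 := by
    refine algebraicallyCompactIdeal_induction (P := fun y => ∀ a, x * a * y = 0) ?_ ?_ ?_ ?_ ?_ ?_
      (star_mem_algebraicallyCompactIdeal hx)
    · simp only [Set.ofPred_forall]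
      exact isClosed_iInter fun a => isClosed_eq (continuous_const.mul continuous_id) continuous_const
    · simp
    · intro y z hy hz a
      rw [mul_add, hy, hz, add_zero]
    · intro b y hy a
      rw [← mul_assoc, mul_assoc x, hy]
    · intro y b hy a
      rw [← mul_assoc, hy, zero_mul]
    · intro q hq a
      obtain ⟨p, hp, b, hb⟩ := hS.exists_corner_ne_zero ⟨q, hq⟩
      obtain ⟨v, c, hvp, hv⟩ := p.2.exists_eq_smul_mul_star hq hb
      have h1 : x * (a * v) = 0 :=
        congrArg leftIdeal.val (DFunLike.congr_fun (h p hp)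
          (leftIdeal.mk (a * v) (by rw [mul_assoc, hvp])))
      rw [hv, mul_smul_comm, ← mul_assoc, mul_assoc x, h1, zero_mul, smul_zero]
  have := key 1
  rw [mul_one] at this
  exact (CStarRing.mul_star_self_eq_zero_iff x).1 this

end IsTransversal

/-- The representation of `C(A)` by compact operators on `A p`. -/
noncomputable def compactRep (p : MinimalProjection A) :
    algebraicallyCompact A →⋆ₙₐ[ℂ] compactOperators (leftIdeal p) :=
  NonUnitalStarAlgHom.codRestrict
    ((rep p).comp (NonUnitalStarSubalgebraClass.subtype (algebraicallyCompact A)))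
    (compactOperators (leftIdeal p)) fun x => isCompactOperator_rep p x.2

namespace IsTransversal

variable {S : Set (MinimalProjection A)}

theorem eq_zero_of_compactRep_eq_zero (hS : IsTransversal S) (x : algebraicallyCompact A)
    (h : ∀ p : S, compactRep p.1 x = 0) : x = 0 :=
  Subtype.ext <| hS.eq_zero_of_rep_eq_zero x.2 fun p hp => congrArg Subtype.val (h ⟨p, hp⟩)

theorem norm_compactRep_le (p : S) (x : algebraicallyCompact A) : ‖compactRep p.1 x‖ ≤ ‖x‖ :=
  norm_rep_le p.1 (x : A)

theorem finite_le_norm_compactRep (hS : IsTransversal S) (x : algebraicallyCompact A) (ε : ℝ)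
    (hε : 0 < ε) : {p : S | ε ≤ ‖compactRep p.1 x‖}.Finite :=
  hS.finite_le_norm_rep x.2 hε

/-- Every compact operator on one of the left ideals `A p` is given by an element of `C(A)` that
acts as zero on the others. -/
theorem exists_rep_eq (hS : IsTransversal S) (p : S) {T : leftIdeal p.1 →L[ℂ] leftIdeal p.1}
    (hT : IsCompactOperator T) :
    ∃ x : algebraicallyCompact A, rep p.1 x = T ∧ ∀ q : S, q ≠ p → rep q.1 (x : A) = 0 := by
  let G : Submodule ℂ A :=
    { carrier := {x | x ∈ algebraicallyCompact A ∧ ∀ q : S, q ≠ p → rep q.1 x = 0}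
      zero_mem' := ⟨zero_mem _, fun q _ => map_zero _⟩
      add_mem' := fun hx hy => ⟨add_mem hx.1 hy.1, fun q hq => by
        rw [map_add, hx.2 q hq, hy.2 q hq, add_zero]⟩
      smul_mem' := fun c x hx => ⟨SMulMemClass.smul_mem c hx.1, fun q hq => by
        rw [map_smul, hx.2 q hq, smul_zero]⟩ }
  have hG : IsClosed (G : Set A) := by
    suffices h : IsClosed {x : A | ∀ q : S, q ≠ p → rep q.1 x = 0} from
      (isClosed_algebraicallyCompact A).inter h
    simp only [Set.ofPred_forall]
    exact isClosed_iInter fun q => isClosed_iInter fun _ =>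
      isClosed_eq (continuous_rep q.1) continuous_const
  have : CompleteSpace G := hG.completeSpace_coe
  let f : G →ₗ[ℂ] (leftIdeal p.1 →L[ℂ] leftIdeal p.1) :=
    { toFun := fun x => rep p.1 x
      map_add' := fun x y => map_add (rep p.1) (x : A) y
      map_smul' := fun c x => map_smul (rep p.1) c (x : A) }
  -- On `G` only the component at `p` can be non-zero, so it carries the whole norm; the range of
  -- `f` is therefore closed, and it suffices to reach the rank-one operators.
  have hf : Isometry f := AddMonoidHomClass.isometry_of_norm f fun x =>
    norm_eq_norm_component (φ := fun p : S => compactRep p.1) norm_compactRep_le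
      hS.finite_le_norm_compactRep hS.eq_zero_of_compactRep_eq_zero (x := ⟨x, x.2.1⟩) (t := p)
      fun q hq => Subtype.ext (x.2.2 q hq)
  have hclosed : IsClosed (LinearMap.range f : Set (leftIdeal p.1 →L[ℂ] leftIdeal p.1)) := by
    rw [LinearMap.coe_range]
    exact hf.isClosedEmbedding.isClosed_range
  have hspan : T ∈ LinearMap.range f := by
    refine closure_minimal (SetLike.coe_subset_coe.2 (Submodule.span_le.2 ?_)) hclosed
      hT.mem_closure_span_rankOne
    rintro _ ⟨x, y, rfl⟩
    refine ⟨⟨(x : A) * star (y : A), ?_, fun q hq => ?_⟩, rep_mul_star p.1 x y⟩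
    -- The element `x y* = x p y*` lies in the ideal because `p` does.
    · rw [← coe_mul_self p.1 x, mul_assoc]
      exact (algebraicallyCompactIdeal A).mul_mem_left _ _
        ((algebraicallyCompactIdeal A).mul_mem_right _ _ p.1.2.2.mem_algebraicallyCompactIdeal)
    · refine rep_eq_zero_of_corner fun a => ?_
      have h0 := hS.corner_eq_zero p.2 q.2 (fun h => hq (Subtype.ext h.symm)) (star (y : A) * a)
      rw [← mul_star_coe]
      simp only [mul_assoc] at h0 ⊢
      rw [h0, mul_zero]
  obtain ⟨x, hx⟩ := hspan
  exact ⟨⟨x, x.2.1⟩, hx, x.2.2⟩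

end IsTransversal

end MinimalProjection

end DualAlgebra

theorem theorem13 (A : Type*) [CStarAlgebra A] :
    IsDualAlgebra (algebraicallyCompact A) := by
  obtain ⟨S, hS⟩ := MinimalProjection.exists_isTransversal A
  -- The index set consists of elements of `A` and each `A p` is a subspace of `A`, so both stay in
  -- the universe of `A`, as `IsDualAlgebra` requires.
  refine ⟨S, fun p => compactOperators (MinimalProjection.leftIdeal p.1), fun _ => inferInstance,
    fun p => ⟨MinimalProjection.leftIdeal p.1, inferInstance, inferInstance, inferInstance,
      ⟨StarAlgEquiv.refl _ _⟩⟩, ⟨StarAlgEquiv.ofBijective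
      (cstarDirectSumLift (fun p : S => MinimalProjection.compactRep p.1)
        MinimalProjection.IsTransversal.norm_compactRep_le hS.finite_le_norm_compactRep)
      ⟨injective_cstarDirectSumLift hS.eq_zero_of_compactRep_eq_zero,
        surjective_cstarDirectSumLift hS.eq_zero_of_compactRep_eq_zero fun p k => ?_⟩⟩⟩
  obtain ⟨x, hx, hx0⟩ := hS.exists_rep_eq p k.2
  exact ⟨x, Subtype.ext hx, fun q hq => Subtype.ext (hx0 q hq)⟩
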